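/- Let $n\in\mathbb N$, $L>0$, and let $V(x,s)=V(x,s)^*\in M_n(\mathbb C)$ $(x,s\in\mathbb R)$ be a Hermitian matrix-valued potential that is continuous in $x$ and satisfies $V(x+L,s)=V(x,s)$. For each $s$ let $H(s)=-\frac{d^2}{dx^2}+V(x,s)$ be the Hamiltonian acting on $L^2(\mathbb R_x,\mathbb C^n)$, with domain the Sobolev space $H^2(\mathbb R,\mathbb C^n)$. Fix $s\in\mathbb R$ and $z\in\mathbb C$ with $z\notin\sigma(H(s))$, and $x_0\in\mathbb R$. Consider the solutions $\psi(x)\in\mathbb C^n$ (column vectors) of $$-\psi''(x)+V(x,s)\psi(x)=z\psi(x)\qquad(1)$$ and the solutions $\widetilde\psi(x)\in\mathbb C^n$ (row vectors) of the adjoint equation $$-\widetilde\psi''(x)+\widetilde\psi(x)V(x,s)=z\widetilde\psi(x),\qquad(2)$$ for $x\in\mathbb R$; they are determined by their initial data $\Psi=(\psi(x_0),\psi'(x_0))$, respectively $\widetilde\Psi=(\widetilde\psi(x_0),\widetilde\psi'(x_0))$, in $\mathbb C^n\oplus\mathbb C^n$. Let $$V^+_{(z,s,x_0)}=\{\Psi\in\mathbb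 C^n\oplus\mathbb C^n \mid \text{the solution }\psi\text{ of (1) with data }\Psi\text{ at }x_0\text{ is }L^2\text{ at }x=+\infty\},$$ $$\widetilde V^-_{(z,s,x_0)}=\{\widetilde\Psi\in\mathbb C^n\oplus\mathbb C^n \mid \text{the solution }\widetilde\psi\text{ of (2) with data }\widetilde\Psi\text{ at }x_0\text{ is }L^2\text{ at }x=-\infty\},$$ and let $\omega$ be the bilinear form on $\mathbb C^n\oplus\mathbb C^n$ given by $$\omega(\widetilde\Psi,\Psi)=\widetilde\psi\,\psi'-\widetilde\psi'\,\psi,\qquad \Psi=(\psi,\psi'),\ \widetilde\Psi=(\widetilde\psi,\widetilde\psi').$$ Then: (i) $V^+_{(z,s,x_0+L)}=V^+_{(z,s,x_0)}$ and $\widetilde V^-_{(z,s,x_0+L)}=\widetilde V^-_{(z,s,x_0)}$. (ii) $\dim V^+_{(z,s,x_0)}=n$ and $\dim\widetilde V^-_{(z,s,x_0)}=n$. (iii) The restriction of $\omega$ to $\widetilde V^-_{(z,s,x_0)}\times V^+_{(z,s,x_0)}$ is non-degenerate, that is: if $\widetilde\Psi\in\widetilde V^-_{(z,s,x_0)}$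 and $\omega(\widetilde\Psi,\Psi)=0$ for all $\Psi\in V^+_{(z,s,x_0)}$, then $\widetilde\Psi=0$; and if $\Psi\in V^+_{(z,s,x_0)}$ and $\omega(\widetilde\Psi,\Psi)=0$ for all $\widetilde\Psi\in\widetilde V^-_{(z,s,x_0)}$, then $\Psi=0$. -/

import Mathlib

open MeasureTheory

namespace ThoulessPump

/-- `ℂⁿ` with its Hermitian norm; its elements serve as columns or as rows. -/
abbrev Cn (n : ℕ) : Type := EuclideanSpace ℂ (Fin n)

/-- The product `M v` of a matrix and a column vector. -/
def mulCol {n : ℕ} (M : Matrix (Fin n) (Fin n) ℂ) (v : Cn n) : Cn n :=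
  WithLp.toLp 2 (M.mulVec v.ofLp)

/-- The product `v M` of a row vector and a matrix. -/
def rowMul {n : ℕ} (v : Cn n) (M : Matrix (Fin n) (Fin n) ℂ) : Cn n :=
  WithLp.toLp 2 (Matrix.vecMul v.ofLp M)

lemma mulCol_add {n : ℕ} (M : Matrix (Fin n) (Fin n) ℂ) (v w : Cn n) :
    mulCol M (v + w) = mulCol M v + mulCol M w := by
  simp [mulCol, Matrix.mulVec_add]

lemma mulCol_smul {n : ℕ} (M : Matrix (Fin n) (Fin n) ℂ) (c : ℂ) (v : Cn n) :
    mulCol M (c • v) = c • mulCol M v := by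
  simp [mulCol, Matrix.mulVec_smul]

lemma mulCol_zero {n : ℕ} (M : Matrix (Fin n) (Fin n) ℂ) : mulCol M 0 = 0 := by
  simp [mulCol]

lemma rowMul_add {n : ℕ} (M : Matrix (Fin n) (Fin n) ℂ) (v w : Cn n) :
    rowMul (v + w) M = rowMul v M + rowMul w M := by
  simp [rowMul, Matrix.add_vecMul]

lemma rowMul_smul {n : ℕ} (M : Matrix (Fin n) (Fin n) ℂ) (c : ℂ) (v : Cn n) :
    rowMul (c • v) M = c • rowMul v M := by
  simp [rowMul, Matrix.smul_vecMul]

lemma rowMul_zero {n : ℕ} (M : Matrix (Fin n) (Fin n) ℂ) : rowMul 0 M = 0 := by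
  simp [rowMul]

/-! ### Resolvent set and spectrum of an unbounded operator -/

/-- `z` belongs to the resolvent set of the (possibly unbounded) operator `A` if
`A - z : D(A) → E` is a bijection with bounded inverse `R`. -/
def resolventSetOf {E : Type*} [NormedAddCommGroup E] [NormedSpace ℂ E]
    (A : E →ₗ.[ℂ] E) : Set ℂ :=
  {z | ∃ R : E →L[ℂ] E,
    (∀ f : E, ∃ h : R f ∈ A.domain, A ⟨R f, h⟩ - z • R f = f) ∧
    ∀ f : A.domain, R (A f - z • (f : E)) = (f : E)}

/-- The spectrum of a (possibly unbounded) operator. -/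
def spectrumOf {E : Type*} [NormedAddCommGroup E] [NormedSpace ℂ E]
    (A : E →ₗ.[ℂ] E) : Set ℂ :=
  (resolventSetOf A)ᶜ

/-! ### The Hamiltonian on `L²(ℝ, ℂⁿ)` -/

/-- The Hilbert space `L²(ℝ, ℂⁿ)`. -/
abbrev L2 (n : ℕ) : Type := Lp (Cn n) 2 (volume : Measure ℝ)

/-- `u` is (the continuously differentiable representative of) an element of the Sobolev space
`H²(ℝ, ℂⁿ)`, with first derivative `v` and second derivative `w`: all three are square
integrable, `u' = v` everywhere, and `v` is the indefinite integral of `w`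
(that is, `v` is locally absolutely continuous with `v' = w` almost everywhere). -/
structure IsH2 {n : ℕ} (u v w : ℝ → Cn n) : Prop where
  memLp : MemLp u 2 volume
  memLp_deriv : MemLp v 2 volume
  memLp_deriv2 : MemLp w 2 volume
  hasDerivAt : ∀ x, HasDerivAt u (v x) x
  eq_integral : ∀ x, v x = v 0 + ∫ t in (0 : ℝ)..x, w t

lemma IsH2.intervalIntegrable {n : ℕ} {u v w : ℝ → Cn n} (h : IsH2 u v w) (a b : ℝ) :
    IntervalIntegrable w volume a b :=
  ((h.memLp_deriv2.locallyIntegrable (by norm_num)).integrableOn_isCompact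
    isCompact_uIcc).intervalIntegrable

lemma IsH2.zero (n : ℕ) : IsH2 (0 : ℝ → Cn n) 0 0 where
  memLp := MemLp.zero
  memLp_deriv := MemLp.zero
  memLp_deriv2 := MemLp.zero
  hasDerivAt := fun x => hasDerivAt_const x 0
  eq_integral := fun x => by simp

lemma IsH2.add {n : ℕ} {u v w u' v' w' : ℝ → Cn n} (h : IsH2 u v w) (h' : IsH2 u' v' w') :
    IsH2 (u + u') (v + v') (w + w') where
  memLp := h.memLp.add h'.memLp
  memLp_deriv := h.memLp_deriv.add h'.memLp_deriv
  memLp_deriv2 := h.memLp_deriv2.add h'.memLp_deriv2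
  hasDerivAt := fun x => (h.hasDerivAt x).add (h'.hasDerivAt x)
  eq_integral := fun x => by
    have := intervalIntegral.integral_add (h.intervalIntegrable 0 x) (h'.intervalIntegrable 0 x)
    simp only [Pi.add_apply, this, h.eq_integral x, h'.eq_integral x]
    abel

lemma IsH2.smul {n : ℕ} {u v w : ℝ → Cn n} (c : ℂ) (h : IsH2 u v w) :
    IsH2 (c • u) (c • v) (c • w) where
  memLp := h.memLp.const_smul c
  memLp_deriv := h.memLp_deriv.const_smul c
  memLp_deriv2 := h.memLp_deriv2.const_smul c
  hasDerivAt := fun x => (h.hasDerivAt x).const_smul c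
  eq_integral := fun x => by
    simp only [Pi.smul_apply, intervalIntegral.integral_smul, h.eq_integral x, smul_add]

/-- The second derivative is determined almost everywhere by the class of the function. -/
lemma IsH2.deriv2_eq_zero {n : ℕ} {u v w : ℝ → Cn n} (h : IsH2 u v w) (hu : u =ᵐ[volume] 0) :
    u = 0 ∧ w =ᵐ[volume] 0 := by
  have hc : Continuous u := continuous_iff_continuousAt.2 fun x => (h.hasDerivAt x).continuousAt
  have hu0 : u = 0 := (hc.ae_eq_iff_eq volume continuous_zero).1 hu
  refine ⟨hu0, ?_⟩
  have hv : ∀ x, v x = 0 := fun x => by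
    have h1 := h.hasDerivAt x
    rw [hu0] at h1
    exact h1.unique (hasDerivAt_const x 0)
  have hI : ∀ x, ∫ t in (0 : ℝ)..x, w t = 0 := fun x => by
    have h1 := h.eq_integral x
    rw [hv, hv] at h1
    simpa using h1.symm
  have hd := LocallyIntegrable.ae_hasDerivAt_integral
    (h.memLp_deriv2.locallyIntegrable (by norm_num))
  filter_upwards [hd] with x hx
  have h1 := hx 0
  have h2 : (fun y => ∫ t in (0 : ℝ)..y, w t) = fun _ => 0 := funext hI
  rw [h2] at h1
  exact h1.unique (hasDerivAt_const x 0)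

/-- The graph of `H(s) = -d²/dx² + V(·, s)` in `L²(ℝ, ℂⁿ) × L²(ℝ, ℂⁿ)`: the pairs
`(u, -u'' + V(·, s) u)` with `u` in `H²(ℝ, ℂⁿ)` (and `V(·, s) u` in `L²`, which is automatic for
bounded potentials). -/
def hamiltonianGraph {n : ℕ} (V : ℝ → ℝ → Matrix (Fin n) (Fin n) ℂ) (s : ℝ) :
    Submodule ℂ (L2 n × L2 n) where
  carrier := {p | ∃ u v w : ℝ → Cn n, IsH2 u v w ∧ p.1 =ᵐ[volume] u ∧
    p.2 =ᵐ[volume] fun x => -w x + mulCol (V x s) (u x)}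
  zero_mem' := by
    refine ⟨0, 0, 0, IsH2.zero n, Lp.coeFn_zero _ _ _, ?_⟩
    refine (Lp.coeFn_zero _ _ _).trans (Filter.Eventually.of_forall fun x => ?_)
    simp [mulCol_zero]
  add_mem' := by
    rintro p q ⟨u, v, w, h, h1, h2⟩ ⟨u', v', w', h', h1', h2'⟩
    refine ⟨u + u', v + v', w + w', h.add h', ?_, ?_⟩
    · exact (Lp.coeFn_add _ _).trans (h1.add h1')
    · refine (Lp.coeFn_add _ _).trans ((h2.add h2').trans ?_)
      refine Filter.Eventually.of_forall fun x => ?_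
      simp only [Pi.add_apply, mulCol_add]
      abel
  smul_mem' := by
    rintro c p ⟨u, v, w, h, h1, h2⟩
    refine ⟨c • u, c • v, c • w, h.smul c, ?_, ?_⟩
    · exact (Lp.coeFn_smul c _).trans (h1.const_smul c)
    · refine (Lp.coeFn_smul c _).trans ((h2.const_smul c).trans ?_)
      refine Filter.Eventually.of_forall fun x => ?_
      simp only [Pi.smul_apply, mulCol_smul, smul_add, smul_neg]

/-- The Hamiltonian `H(s) = -d²/dx² + V(·, s)` as an unbounded operator on `L²(ℝ, ℂⁿ)` with
domain `H²(ℝ, ℂⁿ)`. -/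
noncomputable def hamiltonian {n : ℕ} (V : ℝ → ℝ → Matrix (Fin n) (Fin n) ℂ) (s : ℝ) :
    L2 n →ₗ.[ℂ] L2 n :=
  (hamiltonianGraph V s).toLinearPMap

/-- The operator `hamiltonian V s` does have the graph it is built from. -/
lemma hamiltonian_graph {n : ℕ} (V : ℝ → ℝ → Matrix (Fin n) (Fin n) ℂ) (s : ℝ) :
    (hamiltonian V s).graph = hamiltonianGraph V s := by
  refine Submodule.toLinearPMap_graph_eq _ ?_
  rintro ⟨f, g⟩ ⟨u, v, w, h, h1, h2⟩ hf
  simp only at hf h1 h2 ⊢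
  subst hf
  obtain ⟨hu, hw⟩ := h.deriv2_eq_zero (h1.symm.trans (Lp.coeFn_zero _ _ _))
  refine Lp.ext (h2.trans (Filter.EventuallyEq.trans ?_ (Lp.coeFn_zero _ _ _).symm))
  filter_upwards [hw] with x hx
  simp [hx, hu, mulCol_zero]

/-! ### Solutions of the Schrödinger equation and of its adjoint -/

/-- `ψ`, with derivative `ψ'`, solves `-ψ'' + V(x, s) ψ = z ψ` on the whole line
(column vectors). -/
def IsSolution {n : ℕ} (V : ℝ → ℝ → Matrix (Fin n) (Fin n) ℂ) (z : ℂ) (s : ℝ)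
    (ψ ψ' : ℝ → Cn n) : Prop :=
  ∀ x, HasDerivAt ψ (ψ' x) x ∧ HasDerivAt ψ' (mulCol (V x s) (ψ x) - z • ψ x) x

/-- `ψ`, with derivative `ψ'`, solves the adjoint equation `-ψ'' + ψ V(x, s) = z ψ` on the whole
line (row vectors). -/
def IsAdjointSolution {n : ℕ} (V : ℝ → ℝ → Matrix (Fin n) (Fin n) ℂ) (z : ℂ) (s : ℝ)
    (ψ ψ' : ℝ → Cn n) : Prop :=
  ∀ x, HasDerivAt ψ (ψ' x) x ∧ HasDerivAt ψ' (rowMul (ψ x) (V x s) - z • ψ x) x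

/-- `ψ` is `L²` at `x = +∞`. -/
def IsL2AtTop {n : ℕ} (ψ : ℝ → Cn n) : Prop :=
  ∃ a : ℝ, MemLp ψ 2 (volume.restrict (Set.Ioi a))

/-- `ψ` is `L²` at `x = -∞`. -/
def IsL2AtBot {n : ℕ} (ψ : ℝ → Cn n) : Prop :=
  ∃ a : ℝ, MemLp ψ 2 (volume.restrict (Set.Iio a))

lemma IsL2AtTop.add {n : ℕ} {ψ φ : ℝ → Cn n} (h : IsL2AtTop ψ) (h' : IsL2AtTop φ) :
    IsL2AtTop (ψ + φ) := by
  obtain ⟨a, ha⟩ := h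
  obtain ⟨b, hb⟩ := h'
  exact ⟨max a b,
    (ha.mono_measure (Measure.restrict_mono (Set.Ioi_subset_Ioi (le_max_left a b)) le_rfl)).add
    (hb.mono_measure (Measure.restrict_mono (Set.Ioi_subset_Ioi (le_max_right a b)) le_rfl))⟩

lemma IsL2AtBot.add {n : ℕ} {ψ φ : ℝ → Cn n} (h : IsL2AtBot ψ) (h' : IsL2AtBot φ) :
    IsL2AtBot (ψ + φ) := by
  obtain ⟨a, ha⟩ := h
  obtain ⟨b, hb⟩ := h'
  exact ⟨min a b,
    (ha.mono_measure (Measure.restrict_mono (Set.Iio_subset_Iio (min_le_left a b)) le_rfl)).add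
    (hb.mono_measure (Measure.restrict_mono (Set.Iio_subset_Iio (min_le_right a b)) le_rfl))⟩

/-- The space `V⁺` at `(z, s, x₀)`: the initial data `Ψ = (ψ(x₀), ψ'(x₀))` of the solutions `ψ`
of the Schrödinger equation that are `L²` at `+∞`. -/
def Vplus {n : ℕ} (V : ℝ → ℝ → Matrix (Fin n) (Fin n) ℂ) (z : ℂ) (s x₀ : ℝ) :
    Submodule ℂ (Cn n × Cn n) where
  carrier := {Ψ | ∃ ψ ψ' : ℝ → Cn n, IsSolution V z s ψ ψ' ∧ ψ x₀ = Ψ.1 ∧ ψ' x₀ = Ψ.2 ∧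
    IsL2AtTop ψ}
  zero_mem' := by
    refine ⟨0, 0, fun x => ⟨hasDerivAt_const x 0, ?_⟩, rfl, rfl, 0, MemLp.zero⟩
    refine (hasDerivAt_const x (0 : Cn n)).congr_deriv ?_
    simp [mulCol_zero]
  add_mem' := by
    rintro Ψ Φ ⟨ψ, ψ', h, h1, h2, h3⟩ ⟨φ, φ', k, k1, k2, k3⟩
    refine ⟨ψ + φ, ψ' + φ', fun x => ⟨(h x).1.add (k x).1, ?_⟩, by simp [h1, k1],
      by simp [h2, k2], h3.add k3⟩
    refine ((h x).2.add (k x).2).congr_deriv ?_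
    simp only [Pi.add_apply, mulCol_add, smul_add]
    abel
  smul_mem' := by
    rintro c Ψ ⟨ψ, ψ', h, h1, h2, a, h3⟩
    refine ⟨c • ψ, c • ψ', fun x => ⟨(h x).1.const_smul c, ?_⟩, by simp [h1],
      by simp [h2], a, h3.const_smul c⟩
    refine ((h x).2.const_smul c).congr_deriv ?_
    simp only [Pi.smul_apply, mulCol_smul, smul_sub, smul_comm c z]

/-- The space `Ṽ⁻` at `(z, s, x₀)`: the initial data `Ψ̃ = (ψ̃(x₀), ψ̃'(x₀))` of the solutions
`ψ̃` of the adjoint equation that are `L²` at `-∞`. -/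
def VtildeMinus {n : ℕ} (V : ℝ → ℝ → Matrix (Fin n) (Fin n) ℂ) (z : ℂ) (s x₀ : ℝ) :
    Submodule ℂ (Cn n × Cn n) where
  carrier := {Ψ | ∃ ψ ψ' : ℝ → Cn n, IsAdjointSolution V z s ψ ψ' ∧ ψ x₀ = Ψ.1 ∧ ψ' x₀ = Ψ.2 ∧
    IsL2AtBot ψ}
  zero_mem' := by
    refine ⟨0, 0, fun x => ⟨hasDerivAt_const x 0, ?_⟩, rfl, rfl, 0, MemLp.zero⟩
    refine (hasDerivAt_const x (0 : Cn n)).congr_deriv ?_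
    simp [rowMul_zero]
  add_mem' := by
    rintro Ψ Φ ⟨ψ, ψ', h, h1, h2, h3⟩ ⟨φ, φ', k, k1, k2, k3⟩
    refine ⟨ψ + φ, ψ' + φ', fun x => ⟨(h x).1.add (k x).1, ?_⟩, by simp [h1, k1],
      by simp [h2, k2], h3.add k3⟩
    refine ((h x).2.add (k x).2).congr_deriv ?_
    simp only [Pi.add_apply, rowMul_add, smul_add]
    abel
  smul_mem' := by
    rintro c Ψ ⟨ψ, ψ', h, h1, h2, a, h3⟩
    refine ⟨c • ψ, c • ψ', fun x => ⟨(h x).1.const_smul c, ?_⟩, by simp [h1],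
      by simp [h2], a, h3.const_smul c⟩
    refine ((h x).2.const_smul c).congr_deriv ?_
    simp only [Pi.smul_apply, rowMul_smul, smul_sub, smul_comm c z]

/-- The symplectic form `ω(Ψ̃, Ψ) = ψ̃ ψ' - ψ̃' ψ` (row times column), bilinear over `ℂ`. -/
def omega (n : ℕ) : (Cn n × Cn n) →ₗ[ℂ] (Cn n × Cn n) →ₗ[ℂ] ℂ :=
  LinearMap.mk₂ ℂ
    (fun Ψt Ψ => Ψt.1.ofLp ⬝ᵥ Ψ.2.ofLp - Ψt.2.ofLp ⬝ᵥ Ψ.1.ofLp)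
    (fun a b c => by simp [add_dotProduct]; ring)
    (fun r a b => by simp [smul_dotProduct]; ring)
    (fun a b c => by simp [dotProduct_add]; ring)
    (fun r a b => by simp [dotProduct_smul]; ring)

end ThoulessPump

/-! Translation by a period maps solutions to solutions, which gives (i). For (ii) and (iii), let V⁻
denote the data of column solutions that are L² at -∞.

Upper bounds, for every `z`: Im⟨ψ, ψ'⟩ has derivative -(Im z)‖ψ‖² because the potential is
Hermitian, and it tends to 0 at +∞ if ψ is L² there. Hence a solution in V⁺ with ψ' = -iεψ at x₀,
with ε of the sign of Im z, is zero, and dim V⁺ ≤ n (`finrank_Vplus_le`). Reflection and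
transposition give dim Ṽ⁻ ≤ n and dim V⁻ ≤ n.

Lower bounds use the resolvent. For an adjoint solution η and a cut-off χ supported in [a, b], the
solution u of (H - z)u = χη̄ coincides with an element φ of V⁻ to the left of a and with an element
ψ of V⁺ to the right of b. The Wronskian identity then reads ∫χ‖η‖² = ω(η, φ) - ω(η, ψ)
(`exists_wronskian_identity`). Two consequences follow. If η annihilates V⁺ and V⁻, then η = 0, so
V⁺ + V⁻ is everything and both dimensions are n. If η annihilates V⁻ only, the resolvent bound on ψ
controls ∫χ‖η‖² uniformly as a → -∞, so η lies in Ṽ⁻; by dimension, Ṽ⁻ is exactly the annihilator of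
V⁻.

Thus an element of Ṽ⁻ that annihilates V⁺ annihilates V⁺ + V⁻ and is zero; equality of dimensions
gives the other half of nondegeneracy. -/

namespace ThoulessPump

/-! ### Global solvability of Lipschitz differential equations -/

section LinearODE

variable {E : Type*} [NormedAddCommGroup E] [NormedSpace ℝ E]

/-- The primitive sinh/c of the weight is dominated by the weight divided by c. This gain of 1/c
makes the Picard map a contraction for large c, on both sides of x₀ at once. -/
lemma norm_integral_le_cosh {g : ℝ → E} {M c x₀ : ℝ} (hc : 0 < c) (hM : 0 ≤ M)
    (hg : ∀ t, ‖g t‖ ≤ M * Real.cosh (c * (t - x₀))) (x : ℝ) :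
    ‖∫ t in x₀..x, g t‖ ≤ M / c * Real.cosh (c * (x - x₀)) := by
  have hcont : Continuous fun t => M * Real.cosh (c * (t - x₀)) := by fun_prop
  have hderiv : ∀ t, HasDerivAt (fun t => M / c * Real.sinh (c * (t - x₀)))
      (M * Real.cosh (c * (t - x₀))) t := fun t => by
    have h1 : HasDerivAt (fun t => c * (t - x₀)) c t := by
      simpa using ((hasDerivAt_id t).sub_const x₀).const_mul c
    refine (h1.sinh.const_mul (M / c)).congr_deriv ?_
    field_simp
  refine (intervalIntegral.norm_integral_le_abs_of_norm_le
    (Filter.Eventually.of_forall hg) (hcont.intervalIntegrable _ _)).trans ?_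
  rw [intervalIntegral.integral_eq_sub_of_hasDerivAt (fun t _ => hderiv t)
    (hcont.intervalIntegrable _ _)]
  simp only [sub_self, mul_zero, Real.sinh_zero, sub_zero, abs_mul, abs_of_nonneg (div_nonneg hM hc.le)]
  refine mul_le_mul_of_nonneg_left ?_ (div_nonneg hM hc.le)
  refine abs_le.2 ⟨?_, (Real.sinh_lt_cosh _).le⟩
  have := Real.sinh_lt_cosh (-(c * (x - x₀)))
  rw [Real.sinh_neg, Real.cosh_neg] at this
  linarith

/-- Global existence for an ordinary differential equation whose right-hand side is uniformly
Lipschitz and vanishes at the origin: the Picard map is a contraction for a `cosh`-weighted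
supremum norm. -/
theorem exists_forall_hasDerivAt_of_lipschitz [CompleteSpace E] {f : ℝ → E → E}
    (hf : Continuous (Function.uncurry f)) {K : ℝ} (hK : 0 ≤ K)
    (hlip : ∀ t y y', ‖f t y - f t y'‖ ≤ K * ‖y - y'‖) (hzero : ∀ t, f t 0 = 0)
    (x₀ : ℝ) (y₀ : E) :
    ∃ y : ℝ → E, y x₀ = y₀ ∧ ∀ t, HasDerivAt y (f t (y t)) t := by
  -- Any c > 0 with K / c ≤ 1/2 would do; the `+ 1` keeps c positive when K = 0.
  set c : ℝ := 2 * (K + 1) with hc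
  have hc0 : 0 < c := by positivity
  set ρ : ℝ → ℝ := fun t => Real.cosh (c * (t - x₀)) with hρ
  have hρ1 : ∀ t, 1 ≤ ρ t := fun t => Real.one_le_cosh _
  have hρ0 : ∀ t, 0 < ρ t := fun t => Real.cosh_pos _
  have hρc : Continuous ρ := by fun_prop
  have hbound : ∀ t (y : E), ‖f t y‖ ≤ K * ‖y‖ := fun t y => by
    simpa [hzero] using hlip t y 0
  have hfc : ∀ v : BoundedContinuousFunction ℝ E, Continuous fun t => f t (ρ t • v t) := fun v =>
    hf.comp (continuous_id.prodMk (hρc.smul v.continuous))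
  have hle : ∀ t (y : E), ‖ρ t • y‖ = ρ t * ‖y‖ := fun t y => by
    rw [norm_smul, Real.norm_of_nonneg (hρ0 t).le]
  have hle' : ∀ t (y : E), ‖(ρ t)⁻¹ • y‖ = (ρ t)⁻¹ * ‖y‖ := fun t y => by
    rw [norm_smul, Real.norm_of_nonneg (inv_nonneg.2 (hρ0 t).le)]
  have hprim : ∀ v : BoundedContinuousFunction ℝ E, ∀ x,
      HasDerivAt (fun x => ∫ t in x₀..x, f t (ρ t • v t)) (f x (ρ x • v x)) x := fun v x =>
    ((hfc v).integral_hasStrictDerivAt x₀ x).hasDerivAt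
  have hKc : K / c ≤ 1 / 2 := by
    rw [div_le_div_iff₀ hc0 two_pos]; linarith
  -- The unknown is v = y/ρ, so that solutions with exponential growth become bounded functions and
  -- the ordinary supremum norm applies.
  let T : BoundedContinuousFunction ℝ E → BoundedContinuousFunction ℝ E := fun v =>
    BoundedContinuousFunction.ofNormedAddCommGroup
      (fun x => (ρ x)⁻¹ • (y₀ + ∫ t in x₀..x, f t (ρ t • v t)))
      ((hρc.inv₀ fun t => (hρ0 t).ne').smul (continuous_const.add
        (continuous_iff_continuousAt.2 fun x => (hprim v x).continuousAt)))
      (‖y₀‖ + K * ‖v‖ / c) (fun x => by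
        have h1 := norm_integral_le_cosh (g := fun t => f t (ρ t • v t)) (x₀ := x₀) hc0
          (mul_nonneg hK (norm_nonneg v)) (fun t => by
            refine (hbound t _).trans ?_
            rw [hle, mul_assoc, mul_comm (ρ t)]
            gcongr
            exact v.norm_coe_le_norm t) x
        rw [hle', inv_mul_le_iff₀ (hρ0 x)]
        refine (norm_add_le _ _).trans ?_
        have h2 : ‖y₀‖ ≤ ρ x * ‖y₀‖ := le_mul_of_one_le_left (norm_nonneg _) (hρ1 x)
        have h3 : K * ‖v‖ / c * ρ x = ρ x * (K * ‖v‖ / c) := mul_comm _ _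
        rw [mul_add]
        exact add_le_add h2 (h1.trans h3.le))
  have hT : ∀ v x, T v x = (ρ x)⁻¹ • (y₀ + ∫ t in x₀..x, f t (ρ t • v t)) := fun v x => rfl
  have hcontr : ContractingWith (1 / 2) T := by
    refine ⟨by rw [← NNReal.coe_lt_coe]; norm_num, LipschitzWith.of_dist_le_mul fun v w => ?_⟩
    refine (BoundedContinuousFunction.dist_le (by positivity)).2 fun x => ?_
    rw [dist_eq_norm, hT, hT, ← smul_sub, add_sub_add_left_eq_sub,
      ← intervalIntegral.integral_sub ((hfc v).intervalIntegrable _ _)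
        ((hfc w).intervalIntegrable _ _), hle', inv_mul_le_iff₀ (hρ0 x)]
    refine (norm_integral_le_cosh (M := K * dist v w) (x₀ := x₀) hc0 (by positivity)
      (fun t => ?_) x).trans ?_
    · refine (hlip t _ _).trans ?_
      rw [← smul_sub, hle, mul_assoc, mul_comm (ρ t)]
      gcongr
      rw [← dist_eq_norm]
      exact BoundedContinuousFunction.dist_coe_le_dist t
    · have : K * dist v w / c * ρ x = K / c * (ρ x * dist v w) := by ring
      refine this.le.trans ?_
      have h4 : 0 ≤ ρ x * dist v w := mul_nonneg (hρ0 x).le dist_nonneg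
      refine (mul_le_mul_of_nonneg_right hKc h4).trans_eq ?_
      push_cast
      ring
  obtain ⟨v, hv⟩ : ∃ v, T v = v := ⟨_, hcontr.fixedPoint_isFixedPt⟩
  have hy : ∀ x, ρ x • v x = y₀ + ∫ t in x₀..x, f t (ρ t • v t) := fun x => by
    conv_lhs => rw [← hv, hT]
    rw [smul_inv_smul₀ (hρ0 x).ne']
  refine ⟨fun x => ρ x • v x, by simp [hy x₀], fun x => ?_⟩
  have := (hprim v x).const_add y₀
  exact this.congr_of_eventuallyEq (Filter.Eventually.of_forall hy)

end LinearODE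

/-! ### Initial value problem and local estimates for solutions -/

section Solutions

variable {n : ℕ} {V : ℝ → ℝ → Matrix (Fin n) (Fin n) ℂ} {z : ℂ} {s : ℝ}

lemma mulCol_eq_toEuclideanCLM (M : Matrix (Fin n) (Fin n) ℂ) (v : Cn n) :
    mulCol M v = Matrix.toEuclideanCLM (𝕜 := ℂ) M v := rfl

lemma mulCol_sub (M : Matrix (Fin n) (Fin n) ℂ) (v w : Cn n) :
    mulCol M (v - w) = mulCol M v - mulCol M w := by
  simp [mulCol_eq_toEuclideanCLM]

lemma rowMul_eq_mulCol_transpose (M : Matrix (Fin n) (Fin n) ℂ) (v : Cn n) :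
    rowMul v M = mulCol M.transpose v := by
  simp [mulCol, rowMul, Matrix.mulVec_transpose]

lemma continuous_toEuclideanCLM (hV : Continuous fun x => V x s) :
    Continuous fun x => Matrix.toEuclideanCLM (𝕜 := ℂ) (V x s) :=
  (LinearMap.continuous_of_finiteDimensional
    (Matrix.toEuclideanCLM (n := Fin n) (𝕜 := ℂ)).toAlgEquiv.toLinearMap).comp hV

lemma continuous_mulCol {X : Type*} [TopologicalSpace X] (hV : Continuous fun x => V x s)
    {p : X → ℝ} {g : X → Cn n} (hp : Continuous p) (hg : Continuous g) :
    Continuous fun x => mulCol (V (p x) s) (g x) :=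
  ((continuous_toEuclideanCLM hV).comp hp).clm_apply hg

/-- The potential `V(·, s)` is bounded by `K`, as an operator on column vectors. -/
def IsBoundedPotential (V : ℝ → ℝ → Matrix (Fin n) (Fin n) ℂ) (s K : ℝ) : Prop :=
  0 ≤ K ∧ ∀ x v, ‖mulCol (V x s) v‖ ≤ K * ‖v‖

lemma exists_isBoundedPotential {L : ℝ} (hL : 0 < L) (hV : Continuous fun x => V x s)
    (hper : ∀ x, V (x + L) s = V x s) : ∃ K, IsBoundedPotential V s K := by
  have hp : Function.Periodic (fun x => Matrix.toEuclideanCLM (𝕜 := ℂ) (V x s)) L := fun x => by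
    simp only [hper x]
  obtain ⟨K, hK⟩ := (hp.isBounded_of_continuous hL.ne' (continuous_toEuclideanCLM hV)).exists_norm_le
  refine ⟨K, (norm_nonneg _).trans (hK _ ⟨0, rfl⟩), fun x v => ?_⟩
  exact (ContinuousLinearMap.le_opNorm _ v).trans
    (mul_le_mul_of_nonneg_right (hK _ ⟨x, rfl⟩) (norm_nonneg v))

/-- The right-hand side of the first-order system for `(ψ, ψ')`. -/
def firstOrderField (V : ℝ → ℝ → Matrix (Fin n) (Fin n) ℂ) (z : ℂ) (s : ℝ) (t : ℝ)
    (p : Cn n × Cn n) : Cn n × Cn n :=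
  (p.2, mulCol (V t s) p.1 - z • p.1)

lemma IsBoundedPotential.norm_sub_smul_le {K : ℝ} (hK : IsBoundedPotential V s K) (t : ℝ)
    (v : Cn n) : ‖mulCol (V t s) v - z • v‖ ≤ (K + ‖z‖) * ‖v‖ := by
  refine (norm_sub_le _ _).trans ?_
  rw [norm_smul, add_mul]
  exact add_le_add (hK.2 t v) le_rfl

lemma IsBoundedPotential.lipschitz {K : ℝ} (hK : IsBoundedPotential V s K) (t : ℝ)
    (p q : Cn n × Cn n) :
    ‖firstOrderField V z s t p - firstOrderField V z s t q‖ ≤ (1 + K + ‖z‖) * ‖p - q‖ := by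
  have h0 := hK.1
  have h1 : firstOrderField V z s t p - firstOrderField V z s t q =
      (p.2 - q.2, mulCol (V t s) (p.1 - q.1) - z • (p.1 - q.1)) := by
    simp only [firstOrderField, Prod.mk_sub_mk, mulCol_sub, smul_sub]
    congr 1
    abel
  rw [h1, Prod.norm_mk]
  refine max_le ?_ ((hK.norm_sub_smul_le t _).trans ?_)
  · refine (norm_snd_le (p - q)).trans (le_mul_of_one_le_left (norm_nonneg _) ?_)
    linarith [norm_nonneg z]
  · refine mul_le_mul (by linarith) (norm_fst_le (p - q)) (norm_nonneg _) (by positivity)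

lemma IsBoundedPotential.lipschitzWith {K : ℝ} (hK : IsBoundedPotential V s K) (t : ℝ) :
    LipschitzWith (1 + K + ‖z‖).toNNReal (firstOrderField V z s t) := by
  refine LipschitzWith.of_dist_le_mul fun p q => ?_
  have := hK.1
  rw [dist_eq_norm, dist_eq_norm, Real.coe_toNNReal _ (by positivity)]
  exact hK.lipschitz t p q

/-- The initial value problem is globally solvable. -/
theorem exists_isSolution {K : ℝ} (hV : Continuous fun x => V x s)
    (hK : IsBoundedPotential V s K) (x₀ : ℝ) (Ψ : Cn n × Cn n) :
    ∃ ψ ψ' : ℝ → Cn n, IsSolution V z s ψ ψ' ∧ ψ x₀ = Ψ.1 ∧ ψ' x₀ = Ψ.2 := by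
  have h0 := hK.1
  have hc : Continuous (Function.uncurry (firstOrderField V z s)) := by
    have h1 : Continuous fun q : ℝ × (Cn n × Cn n) => mulCol (V q.1 s) q.2.1 :=
      continuous_mulCol hV continuous_fst (continuous_fst.comp continuous_snd)
    have h2 : Continuous fun q : ℝ × (Cn n × Cn n) => z • q.2.1 := by fun_prop
    exact (continuous_snd.comp continuous_snd).prodMk (h1.sub h2)
  obtain ⟨y, hy0, hy⟩ := exists_forall_hasDerivAt_of_lipschitz hc
    (by positivity : 0 ≤ 1 + K + ‖z‖) hK.lipschitz
    (fun t => by simp [firstOrderField, mulCol_zero]) x₀ Ψ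
  refine ⟨fun t => (y t).1, fun t => (y t).2, fun t => ⟨?_, ?_⟩, by simp only [hy0], by simp only [hy0]⟩
  · exact (hasFDerivAt_fst (𝕜 := ℝ) (p := y t)).comp_hasDerivAt t (hy t)
  · exact (hasFDerivAt_snd (𝕜 := ℝ) (p := y t)).comp_hasDerivAt t (hy t)

lemma IsSolution.hasDerivAt_prod {ψ ψ' : ℝ → Cn n} (h : IsSolution V z s ψ ψ') (t : ℝ) :
    HasDerivAt (fun t => (ψ t, ψ' t)) (firstOrderField V z s t (ψ t, ψ' t)) t :=
  (h t).1.prodMk (h t).2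

lemma IsSolution.continuous {ψ ψ' : ℝ → Cn n} (h : IsSolution V z s ψ ψ') : Continuous ψ :=
  continuous_iff_continuousAt.2 fun x => (h x).1.continuousAt

/-- Solutions on a right half-line are determined by their data at the left end point. -/
lemma IsSolution.eq_on_Ici {K b : ℝ} (hK : IsBoundedPotential V s K) {ψ ψ' u v : ℝ → Cn n}
    (h : IsSolution V z s ψ ψ') (hu : ∀ x, b ≤ x → HasDerivAt u (v x) x)
    (hv : ∀ x, b ≤ x → HasDerivAt v (mulCol (V x s) (u x) - z • u x) x)
    (h1 : ψ b = u b) (h2 : ψ' b = v b) (x : ℝ) (hx : b ≤ x) : ψ x = u x ∧ ψ' x = v x := by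
  have hd : ∀ t, b ≤ t → HasDerivAt (fun t => (u t, v t)) (firstOrderField V z s t (u t, v t)) t :=
    fun t ht => (hu t ht).prodMk (hv t ht)
  have key := ODE_solution_unique (a := b) (b := x) (hK.lipschitzWith (z := z))
    (fun t _ => (h.hasDerivAt_prod t).continuousAt.continuousWithinAt)
    (fun t _ => (h.hasDerivAt_prod t).hasDerivWithinAt)
    (fun t ht => (hd t ht.1).continuousAt.continuousWithinAt)
    (fun t ht => (hd t ht.1).hasDerivWithinAt) (by simp [h1, h2])
  exact Prod.ext_iff.1 (key ⟨hx, le_rfl⟩)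

/-- Solutions on a left half-line are determined by their data at the right end point. -/
lemma IsSolution.eq_on_Iic {K b : ℝ} (hK : IsBoundedPotential V s K) {ψ ψ' u v : ℝ → Cn n}
    (h : IsSolution V z s ψ ψ') (hu : ∀ x, x ≤ b → HasDerivAt u (v x) x)
    (hv : ∀ x, x ≤ b → HasDerivAt v (mulCol (V x s) (u x) - z • u x) x)
    (h1 : ψ b = u b) (h2 : ψ' b = v b) (x : ℝ) (hx : x ≤ b) : ψ x = u x ∧ ψ' x = v x := by
  have hd : ∀ t, t ≤ b → HasDerivAt (fun t => (u t, v t)) (firstOrderField V z s t (u t, v t)) t :=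
    fun t ht => (hu t ht).prodMk (hv t ht)
  have key := ODE_solution_unique_of_mem_Icc_left (a := x) (b := b) (s := fun _ => Set.univ)
    (fun t _ => (hK.lipschitzWith (z := z) t).lipschitzOnWith)
    (fun t _ => (h.hasDerivAt_prod t).continuousAt.continuousWithinAt)
    (fun t _ => (h.hasDerivAt_prod t).hasDerivWithinAt) (fun _ _ => Set.mem_univ _)
    (fun t ht => (hd t ht.2).continuousAt.continuousWithinAt)
    (fun t ht => (hd t ht.2).hasDerivWithinAt) (fun _ _ => Set.mem_univ _) (by simp [h1, h2])
  exact Prod.ext_iff.1 (key ⟨le_rfl, hx⟩)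

/-- The variance of ‖g‖ over an interval of length one is nonnegative. -/
lemma sq_integral_norm_le {g : ℝ → Cn n} (hg : Continuous g) (x : ℝ) :
    (∫ t in x..(x + 1), ‖g t‖) ^ 2 ≤ ∫ t in x..(x + 1), ‖g t‖ ^ 2 := by
  set m := ∫ t in x..(x + 1), ‖g t‖ with hm
  have h0 : 0 ≤ ∫ t in x..(x + 1), (‖g t‖ - m) ^ 2 :=
    intervalIntegral.integral_nonneg (by linarith) fun t _ => sq_nonneg _
  have h1 : ∫ t in x..(x + 1), (‖g t‖ - m) ^ 2 =
      (∫ t in x..(x + 1), ‖g t‖ ^ 2) - 2 * m * m + m ^ 2 := by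
    have : (fun t => (‖g t‖ - m) ^ 2) = fun t => ‖g t‖ ^ 2 - 2 * m * ‖g t‖ + m ^ 2 := by
      ext t; ring
    rw [this, intervalIntegral.integral_add, intervalIntegral.integral_sub,
      intervalIntegral.integral_const_mul, ← hm]
    · simp
    all_goals exact Continuous.intervalIntegrable (by fun_prop) _ _
  nlinarith

/-- Green's formula against a scalar test function vanishing to second order at `x + 1`. -/
lemma IsSolution.norm_boundary_le {K : ℝ} (hV : Continuous fun x => V x s)
    (hK : IsBoundedPotential V s K)
    {ψ ψ' : ℝ → Cn n} (h : IsSolution V z s ψ ψ') {η η' η'' : ℝ → ℝ} {x : ℝ}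
    (hη : ∀ t, HasDerivAt η (η' t) t) (hη' : ∀ t, HasDerivAt η' (η'' t) t)
    (hc : Continuous η'') (h0 : η (x + 1) = 0) (h0' : η' (x + 1) = 0)
    (hb : ∀ t ∈ Set.Icc x (x + 1), |η t| ≤ 1) (hb' : ∀ t ∈ Set.Icc x (x + 1), |η'' t| ≤ 6) :
    ‖η x • ψ' x - η' x • ψ x‖ ≤ (K + ‖z‖ + 6) * ∫ t in x..(x + 1), ‖ψ t‖ := by
  have hηc : Continuous η := continuous_iff_continuousAt.2 fun t => (hη t).continuousAt
  have hd : ∀ t, HasDerivAt (fun t => η t • ψ' t - η' t • ψ t)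
      (η t • (mulCol (V t s) (ψ t) - z • ψ t) - η'' t • ψ t) t := fun t => by
    refine (((hη t).smul (h t).2).sub ((hη' t).smul (h t).1)).congr_deriv ?_
    abel
  have hcont : Continuous fun t => η t • (mulCol (V t s) (ψ t) - z • ψ t) - η'' t • ψ t := by
    have h1 := continuous_mulCol hV continuous_id h.continuous
    have h2 := h.continuous
    simp only [id] at h1
    fun_prop
  have hI := intervalIntegral.integral_eq_sub_of_hasDerivAt (a := x) (b := x + 1)
    (fun t _ => hd t) (hcont.intervalIntegrable _ _)
  simp only [h0, h0', zero_smul, sub_zero, zero_sub] at hI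
  rw [← norm_neg, ← hI, ← intervalIntegral.integral_const_mul]
  have hψ := h.continuous
  refine intervalIntegral.norm_integral_le_of_norm_le (by linarith)
    (Filter.Eventually.of_forall fun t ht => ?_)
    (Continuous.intervalIntegrable (by fun_prop) _ _)
  have ht' : t ∈ Set.Icc x (x + 1) := ⟨ht.1.le, ht.2⟩
  refine (norm_sub_le _ _).trans ?_
  rw [norm_smul, norm_smul, Real.norm_eq_abs, Real.norm_eq_abs, add_mul]
  have hK0 := hK.1
  refine add_le_add ?_ (mul_le_mul_of_nonneg_right (hb' t ht') (norm_nonneg _))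
  have := hK.norm_sub_smul_le (z := z) t (ψ t)
  calc |η t| * ‖mulCol (V t s) (ψ t) - z • ψ t‖ ≤ 1 * ((K + ‖z‖) * ‖ψ t‖) :=
        mul_le_mul (hb t ht') this (norm_nonneg _) zero_le_one
    _ = _ := one_mul _

/-- The values of a solution and of its derivative are controlled by the `L²` norm on an adjacent
unit interval. -/
lemma IsSolution.sq_norm_le {K : ℝ} (hV : Continuous fun x => V x s)
    (hK : IsBoundedPotential V s K) {ψ ψ' : ℝ → Cn n} (h : IsSolution V z s ψ ψ') (x : ℝ) :
    ‖ψ x‖ ^ 2 ≤ (K + ‖z‖ + 6) ^ 2 * ∫ t in x..(x + 1), ‖ψ t‖ ^ 2 ∧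
      ‖ψ' x‖ ^ 2 ≤ (K + ‖z‖ + 6) ^ 2 * ∫ t in x..(x + 1), ‖ψ t‖ ^ 2 := by
  have hlin : ∀ t, HasDerivAt (fun t => t - x) 1 t := fun t => (hasDerivAt_id t).sub_const x
  have hfin : ∀ a : ℝ, 0 ≤ a → a ≤ (K + ‖z‖ + 6) * ∫ t in x..(x + 1), ‖ψ t‖ →
      a ^ 2 ≤ (K + ‖z‖ + 6) ^ 2 * ∫ t in x..(x + 1), ‖ψ t‖ ^ 2 := fun a ha h1 => by
    refine (pow_le_pow_left₀ ha h1 2).trans ?_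
    rw [mul_pow]
    exact mul_le_mul_of_nonneg_left (sq_integral_norm_le h.continuous x) (sq_nonneg _)
  constructor
  · refine hfin _ (norm_nonneg _) ?_
    -- Cubic Hermite polynomial with value 0 and slope 1 at x: the boundary term is -ψ(x).
    have := h.norm_boundary_le hV hK (x := x) (η := fun t => (t - x) * (1 - (t - x)) ^ 2)
      (η' := fun t => (1 - (t - x)) * (1 - 3 * (t - x))) (η'' := fun t => -4 + 6 * (t - x))
      (fun t => ((hlin t).mul (((hlin t).const_sub 1).pow 2)).congr_deriv (by
        simp only [Pi.pow_apply]; ring))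
      (fun t => (((hlin t).const_sub 1).mul (((hlin t).const_mul 3).const_sub 1)).congr_deriv
        (by ring)) (by fun_prop) (by simp) (by simp)
      (fun t ht => by
        have h1 : 0 ≤ t - x := by linarith [ht.1]
        have h2 : t - x ≤ 1 := by linarith [ht.2]
        rw [abs_of_nonneg (by positivity)]
        exact mul_le_one₀ h2 (by positivity) (pow_le_one₀ (by linarith) (by linarith)))
      (fun t ht => abs_le.2 ⟨by linarith [ht.1], by linarith [ht.2]⟩)
    simpa using this
  · refine hfin _ (norm_nonneg _) ?_
    -- Cubic Hermite polynomial with value 1 and slope 0 at x: the boundary term is ψ'(x). Here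
    -- |η''| reaches the bound 6.
    have := h.norm_boundary_le hV hK (x := x)
      (η := fun t => (1 - (t - x)) ^ 2 * (1 + 2 * (t - x)))
      (η' := fun t => -6 * (t - x) * (1 - (t - x))) (η'' := fun t => -6 + 12 * (t - x))
      (fun t => ((((hlin t).const_sub 1).pow 2).mul
        (((hlin t).const_mul 2).const_add 1)).congr_deriv (by simp only [Pi.pow_apply]; ring))
      (fun t => (((hlin t).const_mul (-6)).mul ((hlin t).const_sub 1)).congr_deriv
        (by ring)) (by fun_prop) (by simp) (by simp)
      (fun t ht => by
        have h1 : 0 ≤ t - x := by linarith [ht.1]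
        have h2 : t - x ≤ 1 := by linarith [ht.2]
        rw [abs_of_nonneg (by positivity)]
        nlinarith [mul_nonneg (mul_nonneg h1 h1) (by linarith : 0 ≤ 3 - 2 * (t - x))])
      (fun t ht => abs_le.2 ⟨by linarith [ht.1], by linarith [ht.2]⟩)
    simpa using this

end Solutions

/-! ### Upper bounds for the dimensions -/

section DimensionBound

variable {n : ℕ} {V : ℝ → ℝ → Matrix (Fin n) (Fin n) ℂ} {z : ℂ} {s : ℝ}

lemma IsL2AtTop.tendsto_integral {ψ : ℝ → Cn n} (h : IsL2AtTop ψ) (hc : Continuous ψ) :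
    Filter.Tendsto (fun x => ∫ t in x..(x + 1), ‖ψ t‖ ^ 2) Filter.atTop (nhds 0) := by
  obtain ⟨a, ha⟩ := h
  have hI : IntegrableOn (fun t => ‖ψ t‖ ^ 2) (Set.Ioi a) volume :=
    (memLp_two_iff_integrable_sq_norm ha.1).1 ha
  have hint : ∀ b c : ℝ, IntervalIntegrable (fun t => ‖ψ t‖ ^ 2) volume b c := fun b c =>
    Continuous.intervalIntegrable (by fun_prop) _ _
  have h1 := intervalIntegral_tendsto_integral_Ioi a hI Filter.tendsto_id
  have h2 := intervalIntegral_tendsto_integral_Ioi a hI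
    (Filter.tendsto_atTop_add_const_right Filter.atTop (1 : ℝ) Filter.tendsto_id)
  have h3 := h2.sub h1
  rw [sub_self] at h3
  refine h3.congr fun x => ?_
  exact intervalIntegral.integral_interval_sub_left (hint _ _) (hint _ _)

/-- Only ψ is assumed to be L²; `IsSolution.sq_norm_le` transfers the decay of its integrals over
unit intervals to the values of both ψ and ψ'. -/
lemma IsSolution.tendsto_im_inner {K : ℝ} (hV : Continuous fun x => V x s)
    (hK : IsBoundedPotential V s K) {ψ ψ' : ℝ → Cn n} (h : IsSolution V z s ψ ψ')
    (hL2 : IsL2AtTop ψ) :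
    Filter.Tendsto (fun x => (inner ℂ (ψ x) (ψ' x)).im) Filter.atTop (nhds 0) := by
  have h1 := (hL2.tendsto_integral h.continuous).const_mul ((K + ‖z‖ + 6) ^ 2)
  rw [mul_zero] at h1
  refine squeeze_zero_norm (fun x => ?_) h1
  have h2 := h.sq_norm_le hV hK x
  rw [Real.norm_eq_abs]
  refine (Complex.abs_im_le_norm _).trans ((norm_inner_le_norm _ _).trans ?_)
  nlinarith [sq_nonneg (‖ψ x‖ - ‖ψ' x‖)]

lemma im_inner_mulCol {M : Matrix (Fin n) (Fin n) ℂ} (hM : M.IsHermitian) (v : Cn n) :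
    (inner ℂ v (mulCol M v)).im = 0 := by
  have h := Matrix.isSymmetric_toEuclideanLin_iff.2 hM v v
  have h1 : inner ℂ (mulCol M v) v = inner ℂ v (mulCol M v) := h
  rw [← inner_conj_symm] at h1
  exact Complex.conj_eq_iff_im.1 h1

lemma inner_self_eq_ofReal (v : Cn n) : inner ℂ v v = ((‖v‖ ^ 2 : ℝ) : ℂ) := by
  rw [inner_self_eq_norm_sq_to_K]
  push_cast
  rfl

/-- In ‖ψ'‖² + ⟨ψ, Vψ⟩ - z‖ψ‖² the first two terms are real. -/
lemma IsSolution.hasDerivAt_im_inner (hH : ∀ x, (V x s).IsHermitian) {ψ ψ' : ℝ → Cn n}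
    (h : IsSolution V z s ψ ψ') (x : ℝ) :
    HasDerivAt (fun x => (inner ℂ (ψ x) (ψ' x)).im) (-z.im * ‖ψ x‖ ^ 2) x := by
  have h1 := Complex.imCLM.hasFDerivAt.comp_hasDerivAt x ((h x).1.inner ℂ (h x).2)
  refine h1.congr_deriv ?_
  simp only [Complex.imCLM_apply, Complex.add_im, inner_sub_right, Complex.sub_im,
    im_inner_mulCol (hH x), inner_smul_right, inner_self_eq_ofReal, Complex.ofReal_im,
    Complex.im_mul_ofReal]
  ring

/-- A solution that is square integrable at `+∞` and satisfies the boundary condition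
`ψ'(x₀) = ∓ i ψ(x₀)`, with the sign opposite to that of `Im z`, vanishes at `x₀`. -/
lemma IsSolution.eq_zero_of_boundary {K : ℝ} (hV : Continuous fun x => V x s)
    (hH : ∀ x, (V x s).IsHermitian) (hK : IsBoundedPotential V s K) {ψ ψ' : ℝ → Cn n}
    (h : IsSolution V z s ψ ψ') (hL2 : IsL2AtTop ψ) {x₀ ε : ℝ} (hε : 0 < ε * z.im ∨ (z.im = 0 ∧ ε ≠ 0))
    (hb : ψ' x₀ = (-(ε : ℂ) * Complex.I) • ψ x₀) : ψ x₀ = 0 := by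
  have ht := h.tendsto_im_inner hV hK hL2
  have hd := h.hasDerivAt_im_inner hH
  set b := fun x => (inner ℂ (ψ x) (ψ' x)).im with hbdef
  have hval : b x₀ = -ε * ‖ψ x₀‖ ^ 2 := by
    simp only [hbdef, hb, inner_smul_right, inner_self_eq_ofReal, Complex.im_mul_ofReal]
    simp
  -- Since ε Im z ≥ 0, the function ε·b decreases to 0 (it is constant for real z), so it is
  -- nonnegative at x₀; by the boundary condition its value there is -ε²‖ψ(x₀)‖².
  have hcases : 0 ≤ ε * b x₀ ∧ ε ≠ 0 := by
    have hde : ∀ x, HasDerivAt (fun x => ε * b x) (ε * (-z.im * ‖ψ x‖ ^ 2)) x :=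
      fun x => (hd x).const_mul ε
    have hanti : Antitone fun x => ε * b x := by
      refine antitone_of_deriv_nonpos (fun x => (hde x).differentiableAt) fun x => ?_
      rw [(hde x).deriv]
      have : 0 ≤ ε * z.im := by
        rcases hε with h1 | h1
        · exact h1.le
        · simp [h1.1]
      nlinarith [mul_nonneg this (sq_nonneg ‖ψ x‖)]
    have ht' : Filter.Tendsto (fun x => ε * b x) Filter.atTop (nhds 0) := by
      simpa using ht.const_mul ε
    refine ⟨hanti.le_of_tendsto ht' x₀, ?_⟩
    rcases hε with h1 | h1
    · rintro rfl
      simp at h1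
    · exact h1.2
  rw [hval] at hcases
  have h1 : 0 < ε ^ 2 := by
    have := hcases.2
    positivity
  have h2 : ‖ψ x₀‖ ^ 2 ≤ 0 := by
    by_contra hne
    push Not at hne
    nlinarith [mul_pos h1 hne, hcases.1]
  have h3 : ‖ψ x₀‖ = 0 := by
    have := sq_nonneg ‖ψ x₀‖
    exact pow_eq_zero_iff (two_ne_zero) |>.1 (le_antisymm h2 this)
  exact norm_eq_zero.1 h3

/-- V⁺ meets the n-dimensional space of data with ψ' = -iεψ only in 0, so Ψ ↦ ψ' + iεψ embeds V⁺
into ℂⁿ. -/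
theorem finrank_Vplus_le {K : ℝ} (hV : Continuous fun x => V x s)
    (hH : ∀ x, (V x s).IsHermitian) (hK : IsBoundedPotential V s K) (x₀ : ℝ) :
    Module.finrank ℂ (Vplus V z s x₀) ≤ n := by
  obtain ⟨ε, hε⟩ : ∃ ε : ℝ, 0 < ε * z.im ∨ (z.im = 0 ∧ ε ≠ 0) := by
    by_cases hz : z.im = 0
    · exact ⟨1, Or.inr ⟨hz, one_ne_zero⟩⟩
    · exact ⟨z.im, Or.inl (mul_self_pos.2 hz)⟩
  let T : Cn n × Cn n →ₗ[ℂ] Cn n :=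
    LinearMap.snd ℂ _ _ - (-(ε : ℂ) * Complex.I) • LinearMap.fst ℂ _ _
  have hinj : Function.Injective (T.domRestrict (Vplus V z s x₀)) := by
    rw [← LinearMap.ker_eq_bot, LinearMap.ker_eq_bot']
    rintro ⟨Ψ, ψ, ψ', h, h1, h2, h3⟩ hT
    have hT' : Ψ.2 = (-(ε : ℂ) * Complex.I) • Ψ.1 := sub_eq_zero.1 hT
    have h0 := h.eq_zero_of_boundary hV hH hK h3 hε (by rw [h1, h2, hT'])
    have h4 : Ψ.1 = 0 := by rw [← h1, h0]
    exact Subtype.ext (Prod.ext h4 (by simp [hT', h4]))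
  simpa using LinearMap.finrank_le_finrank_of_injective hinj

lemma memLp_comp_neg {g : ℝ → Cn n} {a : ℝ} (h : MemLp g 2 (volume.restrict (Set.Iio a))) :
    MemLp (fun x => g (-x)) 2 (volume.restrict (Set.Ioi (-a))) := by
  have h1 := (Measure.measurePreserving_neg (volume : Measure ℝ)).restrict_preimage
    (measurableSet_Iio (a := a))
  have h2 : (fun x : ℝ => -x) ⁻¹' Set.Iio a = Set.Ioi (-a) := by
    ext x; simp
  have h3 := h.comp_measurePreserving h1
  rw [Set.neg_preimage] at h3
  simpa [Function.comp_def] using h3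

/-- Reflection and transposition turn adjoint solutions into solutions. -/
lemma IsAdjointSolution.comp_neg {ψ ψ' : ℝ → Cn n} (h : IsAdjointSolution V z s ψ ψ') :
    IsSolution (fun x s => (V (-x) s).transpose) z s (fun x => ψ (-x)) (fun x => -ψ' (-x)) := by
  intro x
  have hneg : HasDerivAt (fun x : ℝ => -x) (-1) x := hasDerivAt_neg x
  constructor
  · simpa [Function.comp_def] using (h (-x)).1.scomp x hneg
  · have := ((h (-x)).2.scomp x hneg).fun_neg
    simpa [Function.comp_def, rowMul_eq_mulCol_transpose] using this

/-- Reflection sends a datum (ψ, ψ') at x₀ to (ψ, -ψ') at -x₀ and embeds Ṽ⁻ into V⁺ of the reflected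
transposed potential, which is again Hermitian and periodic. -/
theorem finrank_VtildeMinus_le {L : ℝ} (hL : 0 < L) (hV : Continuous fun x => V x s)
    (hH : ∀ x, (V x s).IsHermitian) (hper : ∀ x, V (x + L) s = V x s) (x₀ : ℝ) :
    Module.finrank ℂ (VtildeMinus V z s x₀) ≤ n := by
  set V' : ℝ → ℝ → Matrix (Fin n) (Fin n) ℂ := fun x s => (V (-x) s).transpose with hV'
  have hVc : Continuous fun x => V' x s := (hV.comp continuous_neg).matrix_transpose
  obtain ⟨K, hK⟩ := exists_isBoundedPotential hL hVc (fun x => by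
    have := hper (-(x + L))
    simp only [hV']
    rw [← this]
    congr 2
    ring)
  let e : (Cn n × Cn n) ≃ₗ[ℂ] (Cn n × Cn n) :=
    (LinearEquiv.refl ℂ (Cn n)).prodCongr (LinearEquiv.neg ℂ)
  rw [← LinearEquiv.finrank_map_eq e]
  refine (Submodule.finrank_mono ?_).trans
    (finrank_Vplus_le (z := z) hVc (fun x => (hH (-x)).transpose) hK (-x₀))
  rintro _ ⟨Ψ, ⟨ψ, ψ', h, h1, h2, a, h3⟩, rfl⟩
  exact ⟨_, _, h.comp_neg, by simp [e, h1], by simp [e, h2], -a, memLp_comp_neg h3⟩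

end DimensionBound

/-! ### Invariance under translation by a period -/

section Periodicity

variable {n : ℕ} {V : ℝ → ℝ → Matrix (Fin n) (Fin n) ℂ} {z : ℂ} {s : ℝ}

/-- The shift d may have either sign, so applying this to L and to -L yields equality. -/
lemma Vplus_add_le {d : ℝ} (hd : ∀ x, V (x + d) s = V x s) (x₀ : ℝ) :
    Vplus V z s (x₀ + d) ≤ Vplus V z s x₀ := by
  rintro Ψ ⟨ψ, ψ', h, h1, h2, a, h3⟩
  refine ⟨fun x => ψ (x + d), fun x => ψ' (x + d), fun x => ⟨(h (x + d)).1.comp_add_const x d, ?_⟩,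
    h1, h2, a - d, ?_⟩
  · simpa [hd x] using (h (x + d)).2.comp_add_const x d
  · have h4 := (measurePreserving_add_right (volume : Measure ℝ) d).restrict_preimage
      (measurableSet_Ioi (a := a))
    simpa [Function.comp_def] using h3.comp_measurePreserving h4

lemma VtildeMinus_add_le {d : ℝ} (hd : ∀ x, V (x + d) s = V x s) (x₀ : ℝ) :
    VtildeMinus V z s (x₀ + d) ≤ VtildeMinus V z s x₀ := by
  rintro Ψ ⟨ψ, ψ', h, h1, h2, a, h3⟩
  refine ⟨fun x => ψ (x + d), fun x => ψ' (x + d), fun x => ⟨(h (x + d)).1.comp_add_const x d, ?_⟩,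
    h1, h2, a - d, ?_⟩
  · simpa [hd x] using (h (x + d)).2.comp_add_const x d
  · have h4 := (measurePreserving_add_right (volume : Measure ℝ) d).restrict_preimage
      (measurableSet_Iio (a := a))
    simpa [Function.comp_def] using h3.comp_measurePreserving h4

lemma periodic_neg {L : ℝ} (hper : ∀ x, V (x + L) s = V x s) (x : ℝ) :
    V (x + -L) s = V x s := by
  rw [← hper (x + -L), neg_add_cancel_right]

theorem Vplus_add_period {L : ℝ} (hper : ∀ x, V (x + L) s = V x s) (x₀ : ℝ) :
    Vplus V z s (x₀ + L) = Vplus V z s x₀ := by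
  refine le_antisymm (Vplus_add_le hper x₀) ?_
  simpa using Vplus_add_le (z := z) (periodic_neg hper) (x₀ + L)

theorem VtildeMinus_add_period {L : ℝ} (hper : ∀ x, V (x + L) s = V x s) (x₀ : ℝ) :
    VtildeMinus V z s (x₀ + L) = VtildeMinus V z s x₀ := by
  refine le_antisymm (VtildeMinus_add_le hper x₀) ?_
  simpa using VtildeMinus_add_le (z := z) (periodic_neg hper) (x₀ + L)

end Periodicity

/-! ### The resolvent and the Wronskian identity -/

section Resolvent

variable {n : ℕ} {V : ℝ → ℝ → Matrix (Fin n) (Fin n) ℂ} {z : ℂ} {s : ℝ}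

lemma sq_norm_eq_integral (F : L2 n) {u : ℝ → Cn n} (hu : F =ᵐ[volume] u) :
    ‖F‖ ^ 2 = ∫ x, ‖u x‖ ^ 2 := by
  have h1 : ((‖F‖ ^ 2 : ℝ) : ℂ) = ∫ x, ((‖u x‖ ^ 2 : ℝ) : ℂ) := by
    have h2 : inner ℂ F F = ((‖F‖ ^ 2 : ℝ) : ℂ) := by
      rw [inner_self_eq_norm_sq_to_K]
      push_cast
      rfl
    rw [← h2, L2.inner_def]
    refine integral_congr_ae ?_
    filter_upwards [hu] with x hx
    rw [hx, inner_self_eq_ofReal]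
  rw [integral_complex_ofReal] at h1
  exact_mod_cast h1

/-- For `z` in the resolvent set and `f` continuous with compact support, the inhomogeneous
equation `(H - z) u = f` has a classical square integrable solution, bounded by `f` in `L²`. -/
theorem exists_resolvent_solution (hV : Continuous fun x => V x s)
    (hz : z ∈ resolventSetOf (hamiltonian V s)) :
    ∃ C : ℝ, 0 ≤ C ∧ ∀ f : ℝ → Cn n, Continuous f → HasCompactSupport f →
      ∃ u v : ℝ → Cn n, (∀ x, HasDerivAt u (v x) x) ∧
        (∀ x, HasDerivAt v (mulCol (V x s) (u x) - z • u x - f x) x) ∧ MemLp u 2 volume ∧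
        ∫ x, ‖u x‖ ^ 2 ≤ C * ∫ x, ‖f x‖ ^ 2 := by
  obtain ⟨R, hR, -⟩ := hz
  refine ⟨‖R‖ ^ 2, sq_nonneg _, fun f hfc hfs => ?_⟩
  have hf : MemLp f 2 volume := hfc.memLp_of_hasCompactSupport hfs
  set F : L2 n := hf.toLp f with hF
  have hFf : F =ᵐ[volume] f := hf.coeFn_toLp
  obtain ⟨hdom, hA⟩ := hR F
  have hmem : (R F, hamiltonian V s ⟨R F, hdom⟩) ∈ hamiltonianGraph V s := by
    rw [← hamiltonian_graph]
    exact LinearPMap.mem_graph _ ⟨R F, hdom⟩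
  obtain ⟨u, v, w, hH2, h1, h2⟩ := hmem
  rw [sub_eq_iff_eq_add.1 hA] at h2
  simp only at h1 h2
  have hu : Continuous u := continuous_iff_continuousAt.2 fun x => (hH2.hasDerivAt x).continuousAt
  have hg : Continuous fun x => mulCol (V x s) (u x) - z • u x - f x := by
    have := continuous_mulCol hV continuous_id hu
    simp only [id] at this
    fun_prop
  have hw : w =ᵐ[volume] fun x => mulCol (V x s) (u x) - z • u x - f x := by
    filter_upwards [h1, h2, Lp.coeFn_add F (z • R F), Lp.coeFn_smul z (R F), hFf]
      with x hx1 hx2 hx3 hx4 hx5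
    rw [hx3, Pi.add_apply, hx4, Pi.smul_apply, hx1, hx5] at hx2
    have : w x = mulCol (V x s) (u x) - (-w x + mulCol (V x s) (u x)) := by abel
    rw [this, ← hx2]
    abel
  refine ⟨u, v, hH2.hasDerivAt, fun x => ?_, hH2.memLp, ?_⟩
  · have hveq : v = fun x => v 0 + ∫ t in (0 : ℝ)..x, (mulCol (V t s) (u t) - z • u t - f t) := by
      ext1 x
      rw [hH2.eq_integral x]
      congr 1
      refine intervalIntegral.integral_congr_ae ?_
      filter_upwards [hw] with t ht _ using ht
    rw [hveq]
    exact (hg.integral_hasStrictDerivAt 0 x).hasDerivAt.const_add _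
  · rw [← sq_norm_eq_integral _ h1, ← sq_norm_eq_integral _ hFf, ← mul_pow]
    exact pow_le_pow_left₀ (norm_nonneg _) (R.le_opNorm F) 2

lemma hasDerivAt_dotProduct {a b : ℝ → Cn n} {a' b' : Cn n} {x : ℝ} (ha : HasDerivAt a a' x)
    (hb : HasDerivAt b b' x) : HasDerivAt (fun x => (a x).ofLp ⬝ᵥ (b x).ofLp)
      (a'.ofLp ⬝ᵥ (b x).ofLp + (a x).ofLp ⬝ᵥ b'.ofLp) x := by
  have hcoord : ∀ {c : ℝ → Cn n} {c' : Cn n}, HasDerivAt c c' x → ∀ i,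
      HasDerivAt (fun x => (c x).ofLp i) (c'.ofLp i) x := fun {c c'} hc i =>
    ((EuclideanSpace.proj (𝕜 := ℂ) i).restrictScalars ℝ).hasFDerivAt.comp_hasDerivAt x hc
  simp only [dotProduct, ← Finset.sum_add_distrib]
  exact HasDerivAt.fun_sum fun i _ => (hcoord ha i).mul (hcoord hb i)

lemma omega_apply (p q : Cn n × Cn n) :
    omega n p q = p.1.ofLp ⬝ᵥ q.2.ofLp - p.2.ofLp ⬝ᵥ q.1.ofLp := rfl

/-- The Wronskian identity for an adjoint solution and a solution of the inhomogeneous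
equation. -/
lemma IsAdjointSolution.hasDerivAt_omega {η η' u v f : ℝ → Cn n}
    (h : IsAdjointSolution V z s η η') {x : ℝ} (hu : HasDerivAt u (v x) x)
    (hv : HasDerivAt v (mulCol (V x s) (u x) - z • u x - f x) x) :
    HasDerivAt (fun x => omega n (η x, η' x) (u x, v x)) (-((η x).ofLp ⬝ᵥ (f x).ofLp)) x := by
  refine ((hasDerivAt_dotProduct (h x).1 hv).sub
    (hasDerivAt_dotProduct (h x).2 hu)).congr_deriv ?_
  simp only [mulCol, rowMul, WithLp.ofLp_sub, WithLp.ofLp_smul, dotProduct_sub, sub_dotProduct,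
    dotProduct_smul, smul_dotProduct, Matrix.dotProduct_mulVec]
  ring

/-- The Wronskian of an adjoint solution and a solution is constant. -/
lemma IsAdjointSolution.omega_eq {η η' ψ ψ' : ℝ → Cn n}
    (h : IsAdjointSolution V z s η η') (hψ : IsSolution V z s ψ ψ') (x y : ℝ) :
    omega n (η x, η' x) (ψ x, ψ' x) = omega n (η y, η' y) (ψ y, ψ' y) := by
  have hd : ∀ x, HasDerivAt (fun x => omega n (η x, η' x) (ψ x, ψ' x)) 0 x := fun x => by
    simpa using h.hasDerivAt_omega (f := fun _ => 0) (hψ x).1 (by simpa using (hψ x).2)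
  exact is_const_of_deriv_eq_zero (fun x => (hd x).differentiableAt) (fun x => (hd x).deriv) x y

/-- The componentwise complex conjugate. -/
def conjVec (v : Cn n) : Cn n := WithLp.toLp 2 (star v.ofLp)

lemma dotProduct_conjVec (v : Cn n) : v.ofLp ⬝ᵥ (conjVec v).ofLp = ((‖v‖ ^ 2 : ℝ) : ℂ) := by
  rw [← inner_self_eq_ofReal]
  rfl

lemma norm_conjVec (v : Cn n) : ‖conjVec v‖ = ‖v‖ := by
  simp [conjVec, EuclideanSpace.norm_eq]

lemma continuous_conjVec : Continuous (conjVec : Cn n → Cn n) :=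
  (PiLp.continuous_toLp 2 _).comp (continuous_star.comp (PiLp.continuous_ofLp 2 _))

lemma norm_omega_le (p q : Cn n × Cn n) :
    ‖omega n p q‖ ≤ ‖p.1‖ * ‖q.2‖ + ‖p.2‖ * ‖q.1‖ := by
  have h : ∀ a b : Cn n, ‖a.ofLp ⬝ᵥ b.ofLp‖ ≤ ‖a‖ * ‖b‖ := fun a b => by
    have h1 : a.ofLp ⬝ᵥ b.ofLp = inner ℂ (conjVec a) b := by
      simp [conjVec, EuclideanSpace.inner_eq_star_dotProduct, dotProduct_comm]
    rw [h1, ← norm_conjVec a]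
    exact norm_inner_le_norm _ _
  rw [omega_apply]
  exact (norm_sub_le _ _).trans (add_le_add (h _ _) (h _ _))

/-- Testing an adjoint solution against the resolvent: the localized `L²` norm of the adjoint
solution is the difference of its Wronskians with a solution that is square integrable at `-∞`
and one that is square integrable at `+∞`. -/
theorem exists_wronskian_identity {K : ℝ} (hV : Continuous fun x => V x s)
    (hK : IsBoundedPotential V s K) (hz : z ∈ resolventSetOf (hamiltonian V s)) :
    ∃ C : ℝ, 0 ≤ C ∧ ∀ (η η' : ℝ → Cn n), IsAdjointSolution V z s η η' →
      ∀ (χ : ℝ → ℝ) (a b : ℝ), a ≤ b → Continuous χ → (∀ x, 0 ≤ χ x) → (∀ x, χ x ≤ 1) →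
      (∀ x, x ≤ a → χ x = 0) → (∀ x, b ≤ x → χ x = 0) →
      ∃ ψ ψ' φ φ' : ℝ → Cn n, IsSolution V z s ψ ψ' ∧ IsL2AtTop ψ ∧
        IsSolution V z s φ φ' ∧ IsL2AtBot φ ∧
        ((∫ x in a..b, χ x * ‖η x‖ ^ 2 : ℝ) : ℂ) =
          omega n (η a, η' a) (φ a, φ' a) - omega n (η b, η' b) (ψ b, ψ' b) ∧
        ‖ψ b‖ ^ 2 ≤ C * ∫ x in a..b, χ x * ‖η x‖ ^ 2 ∧
        ‖ψ' b‖ ^ 2 ≤ C * ∫ x in a..b, χ x * ‖η x‖ ^ 2 := by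
  obtain ⟨C, hC, hR⟩ := exists_resolvent_solution hV hz
  refine ⟨(K + ‖z‖ + 6) ^ 2 * C, by positivity, fun η η' h χ a b hab hχ h0 h1 ha hb => ?_⟩
  have hη : Continuous η := continuous_iff_continuousAt.2 fun x => (h x).1.continuousAt
  -- The conjugate turns the bilinear pairing of η with f into χ‖η‖².
  set f : ℝ → Cn n := fun x => (χ x : ℂ) • conjVec (η x) with hf
  have hηc : Continuous fun x => conjVec (η x) := continuous_conjVec.comp hη
  have hfc : Continuous f := by fun_prop
  have hfa : ∀ x, x ≤ a → f x = 0 := fun x hx => by simp [hf, ha x hx]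
  have hfb : ∀ x, b ≤ x → f x = 0 := fun x hx => by simp [hf, hb x hx]
  have hfs : HasCompactSupport f :=
    HasCompactSupport.intro (isCompact_Icc (a := a) (b := b)) fun x hx => by
      by_cases hxa : x ≤ a
      · exact hfa x hxa
      · refine hfb x (le_of_lt ?_)
        by_contra hxb
        exact hx ⟨(not_le.1 hxa).le, not_lt.1 hxb⟩
  obtain ⟨u, v, hu, hv, huL, hunorm⟩ := hR f hfc hfs
  -- Beyond b and before a the source f vanishes, so u solves the homogeneous equation there; ψ and
  -- φ continue these two pieces to the whole line.
  obtain ⟨ψ, ψ', hψ, hψ1, hψ2⟩ := exists_isSolution (z := z) hV hK b (u b, v b)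
  obtain ⟨φ, φ', hφ, hφ1, hφ2⟩ := exists_isSolution (z := z) hV hK a (u a, v a)
  have heq := hψ.eq_on_Ici hK (fun x _ => hu x)
    (fun x hx => by simpa [hfb x hx] using hv x) hψ1 hψ2
  have heq' := hφ.eq_on_Iic hK (fun x _ => hu x)
    (fun x hx => by simpa [hfa x hx] using hv x) hφ1 hφ2
  have hdot : ∀ x, (η x).ofLp ⬝ᵥ (f x).ofLp = ((χ x * ‖η x‖ ^ 2 : ℝ) : ℂ) := fun x => by
    rw [hf]
    simp only [WithLp.ofLp_smul, dotProduct_smul, dotProduct_conjVec]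
    push_cast
    rfl
  have huc : Continuous u := continuous_iff_continuousAt.2 fun x => (hu x).continuousAt
  have hI := intervalIntegral.integral_eq_sub_of_hasDerivAt (a := a) (b := b)
    (fun x _ => h.hasDerivAt_omega (hu x) (hv x))
    (by simp only [hdot]; exact Continuous.intervalIntegrable (by fun_prop) _ _)
  simp only [hdot] at hI
  rw [intervalIntegral.integral_neg, intervalIntegral.integral_ofReal] at hI
  -- ‖f‖² = χ²‖η‖² ≤ χ‖η‖², so the integral of the Wronskian identity also bounds the source.
  have hfnorm : ∫ x, ‖f x‖ ^ 2 ≤ ∫ x in a..b, χ x * ‖η x‖ ^ 2 := by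
    have hsupp : ∫ x, ‖f x‖ ^ 2 = ∫ x in a..b, ‖f x‖ ^ 2 := by
      rw [intervalIntegral.integral_of_le hab]
      refine (setIntegral_eq_integral_of_forall_compl_eq_zero fun x hx => ?_).symm
      by_cases hxa : x ≤ a
      · simp [hfa x hxa]
      · have : b ≤ x := by
          by_contra hxb
          exact hx ⟨not_le.1 hxa, (not_le.1 hxb).le⟩
        simp [hfb x this]
    rw [hsupp]
    refine intervalIntegral.integral_mono_on hab (Continuous.intervalIntegrable (by fun_prop) _ _)
      (Continuous.intervalIntegrable (by fun_prop) _ _) fun x _ => ?_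
    rw [hf]
    simp only [norm_smul, Complex.norm_real, Real.norm_of_nonneg (h0 x), norm_conjVec, mul_pow]
    refine mul_le_mul_of_nonneg_right ?_ (sq_nonneg _)
    nlinarith [h0 x, h1 x]
  have hψnorm : ∫ x in b..(b + 1), ‖ψ x‖ ^ 2 ≤ C * ∫ x in a..b, χ x * ‖η x‖ ^ 2 := by
    refine le_trans ?_ (hunorm.trans (mul_le_mul_of_nonneg_left hfnorm hC))
    rw [intervalIntegral.integral_congr (g := fun x => ‖u x‖ ^ 2) (fun x hx => by
      rw [Set.uIcc_of_le (by linarith)] at hx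
      simp only [(heq x hx.1).1]), intervalIntegral.integral_of_le (by linarith)]
    exact setIntegral_le_integral ((memLp_two_iff_integrable_sq_norm huL.1).1 huL)
      (Filter.Eventually.of_forall fun x => sq_nonneg _)
  have hsq := hψ.sq_norm_le hV hK b
  have hmono := mul_le_mul_of_nonneg_left hψnorm (sq_nonneg (K + ‖z‖ + 6))
  rw [← mul_assoc] at hmono
  refine ⟨ψ, ψ', φ, φ', hψ, ⟨b, ?_⟩, hφ, ⟨a, ?_⟩, ?_, hsq.1.trans hmono, hsq.2.trans hmono⟩
  · refine (huL.mono_measure Measure.restrict_le_self).ae_eq ?_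
    filter_upwards [ae_restrict_mem measurableSet_Ioi] with x hx
    exact (heq x (le_of_lt hx)).1.symm
  · refine (huL.mono_measure Measure.restrict_le_self).ae_eq ?_
    filter_upwards [ae_restrict_mem measurableSet_Iio] with x hx
    exact (heq' x (le_of_lt hx)).1.symm
  · rw [hφ1, hφ2, hψ1, hψ2]
    linear_combination -hI

end Resolvent

/-! ### Annihilators of V⁺ and V⁻ -/

section Decomposition

variable {n : ℕ} {V : ℝ → ℝ → Matrix (Fin n) (Fin n) ℂ} {z : ℂ} {s : ℝ}

/-- The space of initial data of the solutions (column vectors) that are `L²` at `-∞`: these are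
the adjoint solutions for the transposed potential. -/
abbrev Vminus (V : ℝ → ℝ → Matrix (Fin n) (Fin n) ℂ) (z : ℂ) (s x₀ : ℝ) :
    Submodule ℂ (Cn n × Cn n) :=
  VtildeMinus (fun x s => (V x s).transpose) z s x₀

lemma isAdjointSolution_iff {ψ ψ' : ℝ → Cn n} : IsAdjointSolution V z s ψ ψ' ↔
    IsSolution (fun x s => (V x s).transpose) z s ψ ψ' := by
  simp only [IsAdjointSolution, IsSolution, rowMul_eq_mulCol_transpose]

lemma mem_Vminus {Ψ : Cn n × Cn n} {x₀ : ℝ} : Ψ ∈ Vminus V z s x₀ ↔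
    ∃ ψ ψ' : ℝ → Cn n, IsSolution V z s ψ ψ' ∧ ψ x₀ = Ψ.1 ∧ ψ' x₀ = Ψ.2 ∧ IsL2AtBot ψ := by
  change (∃ ψ ψ' : ℝ → Cn n, _) ↔ _
  simp only [isAdjointSolution_iff, Matrix.transpose_transpose]

/-- The trapezoidal cut-off function: `1` on `[c, d]` and `0` outside `[c - 1, d + 1]`. -/
def trapezoid (c d x : ℝ) : ℝ := max 0 (min 1 (min (x - c + 1) (d + 1 - x)))

lemma continuous_trapezoid (c d : ℝ) : Continuous (trapezoid c d) := by
  unfold trapezoid; fun_prop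

lemma trapezoid_nonneg (c d x : ℝ) : 0 ≤ trapezoid c d x := le_max_left _ _

lemma trapezoid_le_one (c d x : ℝ) : trapezoid c d x ≤ 1 :=
  max_le zero_le_one (min_le_left _ _)

lemma trapezoid_eq_zero_of_le {c d x : ℝ} (h : x ≤ c - 1) : trapezoid c d x = 0 :=
  max_eq_left ((min_le_right _ _).trans ((min_le_left _ _).trans (by linarith)))

lemma trapezoid_eq_zero_of_ge {c d x : ℝ} (h : d + 1 ≤ x) : trapezoid c d x = 0 :=
  max_eq_left ((min_le_right _ _).trans ((min_le_right _ _).trans (by linarith)))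

lemma trapezoid_eq_one {c d x : ℝ} (h : x ∈ Set.Icc c d) : trapezoid c d x = 1 := by
  have : min 1 (min (x - c + 1) (d + 1 - x)) = 1 :=
    min_eq_left (le_min (by linarith [h.1]) (by linarith [h.2]))
  rw [trapezoid, this, max_eq_right zero_le_one]

lemma integral_le_integral_trapezoid {g : ℝ → ℝ} (hg : Continuous g) (h0 : ∀ x, 0 ≤ g x)
    {c d : ℝ} (hcd : c ≤ d) :
    ∫ x in c..d, g x ≤ ∫ x in (c - 1)..(d + 1), trapezoid c d x * g x := by
  have hχ := continuous_trapezoid c d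
  have h1 : ∫ x in c..d, g x = ∫ x in c..d, trapezoid c d x * g x := by
    refine intervalIntegral.integral_congr fun x hx => ?_
    rw [Set.uIcc_of_le hcd] at hx
    simp only [trapezoid_eq_one hx, one_mul]
  rw [h1]
  exact intervalIntegral.integral_mono_interval (by linarith) hcd (by linarith)
    (Filter.Eventually.of_forall fun x => mul_nonneg (trapezoid_nonneg _ _ _) (h0 x))
    ((hχ.mul hg).intervalIntegrable _ _)

lemma IsAdjointSolution.continuous {η η' : ℝ → Cn n} (h : IsAdjointSolution V z s η η') :
    Continuous η :=
  continuous_iff_continuousAt.2 fun x => (h x).1.continuousAt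

/-- No nonzero adjoint datum annihilates both `V⁺` and `V⁻`. -/
theorem eq_zero_of_omega_eq_zero {K K' : ℝ} (hV : Continuous fun x => V x s)
    (hK : IsBoundedPotential V s K)
    (hK' : IsBoundedPotential (fun x s => (V x s).transpose) s K')
    (hz : z ∈ resolventSetOf (hamiltonian V s)) {x₀ : ℝ} {Ψt : Cn n × Cn n}
    (hp : ∀ Ψ ∈ Vplus V z s x₀, omega n Ψt Ψ = 0) (hm : ∀ Ψ ∈ Vminus V z s x₀, omega n Ψt Ψ = 0) :
    Ψt = 0 := by
  obtain ⟨η, η', h, hη1, hη2⟩ := exists_isSolution (z := z) hV.matrix_transpose hK' x₀ Ψt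
  have had : IsAdjointSolution V z s η η' := isAdjointSolution_iff.2 h
  obtain ⟨C, -, hC⟩ := exists_wronskian_identity hV hK hz
  obtain ⟨ψ, ψ', φ, φ', hψ, hψL, hφ, hφL, hI, -, -⟩ := hC η η' had (trapezoid x₀ (x₀ + 1))
    (x₀ - 1) (x₀ + 1 + 1) (by linarith) (continuous_trapezoid _ _) (trapezoid_nonneg _ _)
    (trapezoid_le_one _ _) (fun x => trapezoid_eq_zero_of_le) (fun x => trapezoid_eq_zero_of_ge)
  have hdata : (η x₀, η' x₀) = Ψt := Prod.ext hη1 hη2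
  -- Constancy of the Wronskians moves both endpoint terms to x₀, where they vanish by hypothesis.
  rw [had.omega_eq hφ _ x₀, had.omega_eq hψ _ x₀, hdata,
    hm _ (mem_Vminus.2 ⟨φ, φ', hφ, rfl, rfl, hφL⟩), hp _ ⟨ψ, ψ', hψ, rfl, rfl, hψL⟩, sub_zero] at hI
  have hI0 : ∫ x in (x₀ - 1)..(x₀ + 1 + 1), trapezoid x₀ (x₀ + 1) x * ‖η x‖ ^ 2 = 0 := by
    exact_mod_cast hI
  have hle := integral_le_integral_trapezoid (g := fun x => ‖η x‖ ^ 2)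
    (by have := had.continuous; fun_prop) (fun x => sq_nonneg _) (by linarith : x₀ ≤ x₀ + 1)
  rw [hI0] at hle
  have hsq := h.sq_norm_le hV.matrix_transpose hK' x₀
  have h0 := mul_nonpos_of_nonneg_of_nonpos (sq_nonneg (K' + ‖z‖ + 6)) hle
  have hz0 : ∀ v : Cn n, ‖v‖ ^ 2 ≤ 0 → v = 0 := fun v hv =>
    norm_eq_zero.1 ((pow_eq_zero_iff two_ne_zero).1 (le_antisymm hv (sq_nonneg _)))
  rw [← hdata, hz0 _ (hsq.1.trans h0), hz0 _ (hsq.2.trans h0)]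
  rfl

/-- An adjoint solution whose datum annihilates `V⁻` is square integrable at `-∞`. -/
theorem mem_VtildeMinus_of_omega_eq_zero {K K' : ℝ} (hV : Continuous fun x => V x s)
    (hK : IsBoundedPotential V s K)
    (hK' : IsBoundedPotential (fun x s => (V x s).transpose) s K')
    (hz : z ∈ resolventSetOf (hamiltonian V s)) {x₀ : ℝ} {Ψt : Cn n × Cn n}
    (hm : ∀ Ψ ∈ Vminus V z s x₀, omega n Ψt Ψ = 0) : Ψt ∈ VtildeMinus V z s x₀ := by
  obtain ⟨η, η', h, hη1, hη2⟩ := exists_isSolution (z := z) hV.matrix_transpose hK' x₀ Ψt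
  have had : IsAdjointSolution V z s η η' := isAdjointSolution_iff.2 h
  -- With x₀ - 1 as the end of the plateau, the cut-off vanishes from x₀ on, so the right-hand
  -- Wronskian is taken at x₀, where the datum of η is fixed as c → -∞.
  refine ⟨η, η', had, hη1, hη2, x₀ - 1, ?_⟩
  obtain ⟨C, hC0, hC⟩ := exists_wronskian_identity hV hK hz
  have hηc := had.continuous
  set D := ‖Ψt.1‖ + ‖Ψt.2‖ with hD
  have hdata : (η x₀, η' x₀) = Ψt := Prod.ext hη1 hη2
  have hbound : ∀ c ≤ x₀ - 1, ∫ x in c..(x₀ - 1), ‖η x‖ ^ 2 ≤ D ^ 2 * C := fun c hc => by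
    refine (integral_le_integral_trapezoid (g := fun x => ‖η x‖ ^ 2) (by fun_prop)
      (fun x => sq_nonneg _) hc).trans ?_
    rw [sub_add_cancel]
    obtain ⟨ψ, ψ', φ, φ', hψ, -, hφ, hφL, hI, h1, h2⟩ := hC η η' had (trapezoid c (x₀ - 1))
      (c - 1) x₀ (by linarith) (continuous_trapezoid _ _) (trapezoid_nonneg _ _)
      (trapezoid_le_one _ _) (fun x => trapezoid_eq_zero_of_le)
      (fun x hx => trapezoid_eq_zero_of_ge (by linarith))
    rw [had.omega_eq hφ _ x₀, hdata, hm _ (mem_Vminus.2 ⟨φ, φ', hφ, rfl, rfl, hφL⟩),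
      zero_sub] at hI
    set I := ∫ x in (c - 1)..x₀, trapezoid c (x₀ - 1) x * ‖η x‖ ^ 2
    have hI0 : 0 ≤ I := intervalIntegral.integral_nonneg (by linarith) fun x _ =>
      mul_nonneg (trapezoid_nonneg _ _ _) (sq_nonneg _)
    have hIn : I ≤ ‖Ψt.1‖ * ‖ψ' x₀‖ + ‖Ψt.2‖ * ‖ψ x₀‖ := by
      refine le_trans (le_of_eq ?_) (norm_omega_le Ψt (ψ x₀, ψ' x₀))
      rw [← norm_neg, ← hI, Complex.norm_real, Real.norm_of_nonneg hI0]
    have h1' := Real.le_sqrt_of_sq_le h1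
    have h2' := Real.le_sqrt_of_sq_le h2
    -- I is bounded by a multiple of its own square root, hence by D²C, independently of c.
    have hIs : I ≤ D * √(C * I) := by
      refine hIn.trans ?_
      rw [hD, add_mul]
      gcongr
    have hsq : I ^ 2 ≤ D ^ 2 * (C * I) := by
      refine (pow_le_pow_left₀ hI0 hIs 2).trans_eq ?_
      rw [mul_pow, Real.sq_sqrt (by positivity)]
    rcases hI0.eq_or_lt with h0 | h0
    · rw [← h0]; positivity
    · refine le_of_mul_le_mul_right ?_ h0
      linarith [hsq, sq I, mul_assoc (D ^ 2) C I]
  have hint : IntegrableOn (fun x => ‖η x‖ ^ 2) (Set.Iic (x₀ - 1)) volume := by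
    refine integrableOn_Iic_of_intervalIntegral_norm_bounded (l := Filter.atBot) (a := id)
      (D ^ 2 * C) (x₀ - 1) (fun c => ?_) Filter.tendsto_id ?_
    · exact (Continuous.integrableOn_Icc (by fun_prop)).mono_set Set.Ioc_subset_Icc_self
    · filter_upwards [Filter.eventually_le_atBot (x₀ - 1)] with c hc
      simpa using hbound c hc
  exact (memLp_two_iff_integrable_sq_norm hηc.aestronglyMeasurable).2
    (hint.mono_set Set.Iio_subset_Iic_self)

end Decomposition

/-! ### Annihilators and nondegeneracy in finite dimension -/

section LinearAlgebra

variable {n : ℕ}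

lemma finrank_Cn_prod : Module.finrank ℂ (Cn n × Cn n) = n + n := by simp

/-- The annihilator is the kernel of a map into the dual of W, whose rank is at most dim W. -/
lemma finrank_annihilator_add (W : Submodule ℂ (Cn n × Cn n)) :
    n + n ≤ Module.finrank ℂ W + Module.finrank ℂ (LinearMap.ker ((omega n).domRestrict₂ W)) := by
  rw [← finrank_Cn_prod, ← LinearMap.finrank_range_add_finrank_ker ((omega n).domRestrict₂ W)]
  refine Nat.add_le_add_right ((Submodule.finrank_le _).trans ?_) _
  rw [Module.finrank_linearMap, Module.finrank_self, mul_one]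

lemma mem_annihilator {W : Submodule ℂ (Cn n × Cn n)} {Ψt : Cn n × Cn n} :
    Ψt ∈ LinearMap.ker ((omega n).domRestrict₂ W) ↔ ∀ Ψ ∈ W, omega n Ψt Ψ = 0 := by
  rw [LinearMap.mem_ker, LinearMap.ext_iff]
  exact ⟨fun h Ψ hΨ => h ⟨Ψ, hΨ⟩, fun h Ψ => h Ψ Ψ.2⟩

/-- A bilinear form that is separating on the left is nondegenerate if both spaces have the same
finite dimension. -/
lemma nondegenerate_of_separatingLeft {F E E' : Type*} [Field F] [AddCommGroup E] [Module F E]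
    [AddCommGroup E'] [Module F E'] [FiniteDimensional F E] [FiniteDimensional F E']
    {B : E →ₗ[F] E' →ₗ[F] F} (hB : B.SeparatingLeft)
    (hdim : Module.finrank F E = Module.finrank F E') : B.Nondegenerate := by
  refine ⟨hB, fun y hy => ?_⟩
  have hinj : Function.Injective B := by
    rw [← LinearMap.ker_eq_bot, LinearMap.ker_eq_bot']
    exact fun x hx => hB x fun y => by rw [hx, LinearMap.zero_apply]
  have hsurj : Function.Surjective B := by
    refine (LinearMap.injective_iff_surjective_of_finrank_eq_finrank ?_).1 hinj
    rw [hdim, Module.finrank_linearMap, Module.finrank_self, mul_one]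
  refine (Module.forall_dual_apply_eq_zero_iff F y).1 fun g => ?_
  obtain ⟨x, rfl⟩ := hsurj g
  exact hy x

end LinearAlgebra

end ThoulessPump

/-! ### Dimension count and conclusion -/

open ThoulessPump in
theorem lemma3p3 {n : ℕ} (V : ℝ → ℝ → Matrix (Fin n) (Fin n) ℂ) (L : ℝ) (hL : 0 < L)
    (hcont : ∀ s, Continuous fun x => V x s)
    (hherm : ∀ x s, (V x s).IsHermitian)
    (hper : ∀ x s, V (x + L) s = V x s)
    (s : ℝ) (z : ℂ) (hz : z ∉ ThoulessPump.spectrumOf (ThoulessPump.hamiltonian V s)) (x₀ : ℝ) :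
    (ThoulessPump.Vplus V z s (x₀ + L) = ThoulessPump.Vplus V z s x₀ ∧
      ThoulessPump.VtildeMinus V z s (x₀ + L) = ThoulessPump.VtildeMinus V z s x₀) ∧
    (Module.finrank ℂ (ThoulessPump.Vplus V z s x₀) = n ∧
      Module.finrank ℂ (ThoulessPump.VtildeMinus V z s x₀) = n) ∧
    ((ThoulessPump.omega n).domRestrict₁₂
      (ThoulessPump.VtildeMinus V z s x₀) (ThoulessPump.Vplus V z s x₀)).Nondegenerate := by
  have hz' : z ∈ resolventSetOf (hamiltonian V s) := not_not.1 hz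
  have hV := hcont s
  have hH : ∀ x, (V x s).IsHermitian := fun x => hherm x s
  have hp : ∀ x, V (x + L) s = V x s := fun x => hper x s
  have hHt : ∀ x, ((V x s).transpose).IsHermitian := fun x => (hH x).transpose
  have hpt : ∀ x, (V (x + L) s).transpose = (V x s).transpose := fun x => by rw [hp]
  obtain ⟨K, hK⟩ := exists_isBoundedPotential hL hV hp
  obtain ⟨K', hK'⟩ := exists_isBoundedPotential (V := fun x s => (V x s).transpose) hL
    hV.matrix_transpose hpt
  have hplus := finrank_Vplus_le (z := z) hV hH hK x₀
  have htilde := finrank_VtildeMinus_le (z := z) hL hV hH hp x₀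
  have hminus : Module.finrank ℂ (Vminus V z s x₀) ≤ n :=
    finrank_VtildeMinus_le (z := z) (V := fun x s => (V x s).transpose) hL hV.matrix_transpose
      hHt hpt x₀
  have hker : LinearMap.ker ((omega n).domRestrict₂ (Vplus V z s x₀ ⊔ Vminus V z s x₀)) = ⊥ := by
    refine (Submodule.eq_bot_iff _).2 fun Ψt h => ?_
    rw [mem_annihilator] at h
    exact eq_zero_of_omega_eq_zero hV hK hK' hz'
      (fun Ψ hΨ => h Ψ (Submodule.mem_sup_left hΨ)) fun Ψ hΨ => h Ψ (Submodule.mem_sup_right hΨ)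
  have hsum := finrank_annihilator_add (Vplus V z s x₀ ⊔ Vminus V z s x₀)
  rw [hker, finrank_bot, add_zero] at hsum
  -- 2n ≤ dim V⁺ + dim V⁻ with both summands at most n, which forces dim V⁺ = n.
  have hadd := hsum.trans (Submodule.finrank_add_le_finrank_add_finrank _ _)
  have hann := finrank_annihilator_add (Vminus V z s x₀)
  have hle : LinearMap.ker ((omega n).domRestrict₂ (Vminus V z s x₀)) ≤ VtildeMinus V z s x₀ :=
    fun Ψt h => mem_VtildeMinus_of_omega_eq_zero hV hK hK' hz' (mem_annihilator.1 h)
  have hmono := Submodule.finrank_mono hle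
  -- The annihilator of V⁻ has dimension at least 2n - n = n and lies in Ṽ⁻, of dimension at most n,
  -- so the two coincide.
  have heq := Submodule.eq_of_le_of_finrank_le hle (by omega)
  have hdims : Module.finrank ℂ (Vplus V z s x₀) = n ∧
      Module.finrank ℂ (VtildeMinus V z s x₀) = n := ⟨by omega, by omega⟩
  refine ⟨⟨Vplus_add_period hp x₀, VtildeMinus_add_period hp x₀⟩, hdims,
    nondegenerate_of_separatingLeft (fun Ψt h => ?_) (hdims.2.trans hdims.1.symm)⟩
  -- Annihilation of V⁺ is the assumption; annihilation of V⁻ is membership in Ṽ⁻, by `heq`.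
  refine Subtype.ext (eq_zero_of_omega_eq_zero hV hK hK' hz' (x₀ := x₀) (fun Ψ hΨ => h ⟨Ψ, hΨ⟩) ?_)
  exact mem_annihilator.1 (heq.ge Ψt.2)
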